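/- Let $1\le p\le\infty$, and let all Banach spaces be over the same scalar field, $\mathbb{R}$ or $\mathbb{C}$. A Banach space $Y$ is a $P_\lambda$-space ($\lambda\ge 1$) if for every Banach space $Z\supseteq Y$ there is a linear projection $P$ of $Z$ onto $Y$ with $\|P\|\le\lambda$. A bounded linear operator $T:X\to Y$ between Banach spaces is $p$-summing if there is $c\ge 0$ such that for all $m\in\mathbb{N}$ and $x_1,\dots,x_m\in X$, $$\Big(\sum_{i=1}^m\|Tx_i\|^p\Big)^{1/p}\le c\,\sup_{x^*\in B_{X^*}}\Big(\sum_{i=1}^m|x^*(x_i)|^p\Big)^{1/p},$$ where $B_{X^*}$ is the closed unit ball of $X^*$ and, for $p=\infty$, the two $\ell_p$-sums are replaced by maxima. The least such $c$ is denoted by $\pi_p(T)$. Let $X$, $Y$, $Z$ be Banach spaces. 1. Let $\lambda\ge 1$ and let $Y$ be a $P_\lambda$-space. (a) If $Z\supseteq X$, then every $p$-summing operator $T:X\to Y$ has a $p$-summing extension $\widetilde T:Z\to Y$ with $\pi_p(\widetilde T)\le\lambda\,\pi_p(T)$. (b) If $Z\supseteq Y$, then every $p$-summing operator $T:Y\to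 X$ has a $p$-summing extension $\widetilde T:Z\to X$ with $\pi_p(\widetilde T)\le\lambda\,\pi_p(T)$. 2. In particular, if $Y$ is a $P_1$-space, then in (a) and in (b) the $p$-summing extension $\widetilde T$ can be chosen with $\pi_p(\widetilde T)=\pi_p(T)$. -/

import Mathlib

open scoped ENNReal

noncomputable section

/-- A Banach space `Y` is a `P_lam`-space (`lam ≥ 1`) if, whenever `Y` sits isometrically as a
subspace of a Banach space `Z`, there is a bounded linear projection of `Z` onto `Y` of norm at most
`lam`. The inclusion is a linear isometry `i : Y → Z`, and a projection onto `Y` is a bounded linear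
map `P : Z → Y` that restricts to the identity of `Y`. The spaces `Z` range over the universe
of `Y`; this already yields projections from superspaces in every universe, because the space of
bounded functions on the dual ball of `Y` lives in the universe of `Y`. The scalar field `𝕜` is `ℝ`
or `ℂ`. -/
def IsPSpace.{v} (𝕜 : Type) [RCLike 𝕜] (lam : ℝ)
    (Y : Type v) [NormedAddCommGroup Y] [NormedSpace 𝕜 Y] : Prop :=
  1 ≤ lam ∧
    ∀ (Z : Type v) [NormedAddCommGroup Z] [NormedSpace 𝕜 Z] [CompleteSpace Z] (i : Y →ₗᵢ[𝕜] Z),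
      ∃ P : Z →L[𝕜] Y, (∀ y : Y, P (i y) = y) ∧ ‖P‖ ≤ lam

/-- The strong `ℓ_p`-norm of a finite family of vectors: `(∑ i, ‖x i‖ ^ p) ^ (1 / p)` for
`1 ≤ p < ∞`, and the maximum of the `‖x i‖` for `p = ∞`. -/
def strongLpNorm (p : ℝ≥0∞) {X : Type*} [NormedAddCommGroup X] {m : ℕ} (x : Fin m → X) : ℝ :=
  ‖(WithLp.toLp p x : PiLp p (fun _ : Fin m => X))‖

/-- The weak `ℓ_p`-norm of a finite family of vectors: the supremum, over the closed unit ball of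
the dual space, of the `ℓ_p`-norm of the scalar family `i ↦ f (x i)`. -/
def weakLpNorm (𝕜 : Type*) [RCLike 𝕜] (p : ℝ≥0∞) {X : Type*} [NormedAddCommGroup X]
    [NormedSpace 𝕜 X] {m : ℕ} (x : Fin m → X) : ℝ :=
  ⨆ f : {f : StrongDual 𝕜 X // ‖f‖ ≤ 1}, strongLpNorm p (fun i => f.1 (x i))

/-- `c ≥ 0` is a `p`-summing constant of `T`: for all finite families `x` in `X`, the strong
`ℓ_p`-norm of `T ∘ x` is at most `c` times the weak `ℓ_p`-norm of `x`. -/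
def IsSummingConst {𝕜 : Type*} [RCLike 𝕜] (p : ℝ≥0∞) {X Y : Type*}
    [NormedAddCommGroup X] [NormedSpace 𝕜 X] [NormedAddCommGroup Y] [NormedSpace 𝕜 Y]
    (T : X →L[𝕜] Y) (c : ℝ) : Prop :=
  0 ≤ c ∧ ∀ (m : ℕ) (x : Fin m → X),
    strongLpNorm p (fun i => T (x i)) ≤ c * weakLpNorm 𝕜 p x

/-- `T` is `p`-summing. -/
def IsPSumming {𝕜 : Type*} [RCLike 𝕜] (p : ℝ≥0∞) {X Y : Type*}
    [NormedAddCommGroup X] [NormedSpace 𝕜 X] [NormedAddCommGroup Y] [NormedSpace 𝕜 Y]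
    (T : X →L[𝕜] Y) : Prop :=
  ∃ c : ℝ, IsSummingConst p T c

/-- The `p`-summing norm `π_p(T)`: the least `p`-summing constant of `T`
(meaningful when `T` is `p`-summing). -/
def summingNorm {𝕜 : Type*} [RCLike 𝕜] (p : ℝ≥0∞) {X Y : Type*}
    [NormedAddCommGroup X] [NormedSpace 𝕜 X] [NormedAddCommGroup Y] [NormedSpace 𝕜 Y]
    (T : X →L[𝕜] Y) : ℝ :=
  sInf {c : ℝ | IsSummingConst p T c}

end

/-!
An operator that starts from a `P_lam`-space `Y` is extended by composing it with a projection onto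
`Y`: this multiplies a summing constant by at most the norm of the projection
(`IsSummingConst.comp`).

For an operator `T : X → Y` into a `P_lam`-space and `X ⊆ Z`, the classical argument factors `T`
through a subspace of an `L_p`-space. Only the `L_p`-seminorm pulled back to `Z` is needed here:
by `IsSummingConst.exists_seminorm`, a summing constant `c` of `T` yields a seminorm `q` on `Z` with
`‖T x‖ ≤ c * q x` on `X` whose strong `ℓ_p`-norm over any finite family in `Z` is at most the weak
`ℓ_p`-norm of the family. For `p = ∞` the norm of `Z` is such a seminorm. For `p < ∞` it is
`q z = M (f ↦ ‖f z‖ ^ p) ^ (1 / p)`, where `M` is a positive normalized functional on the bounded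
continuous functions on the dual unit ball of `Z`. This `M` takes the place of the measure in
Pietsch's domination theorem; it comes from the M. Riesz extension theorem, applied to the cone of
functions that dominate some `f ↦ ∑ (c ^ p ‖f x_j‖ ^ p - ‖T x_j‖ ^ p)`. That constants in this cone
are nonnegative is exactly the summing inequality. Neither compactness of the ball nor countable
additivity plays a role.

An operator into `Y` dominated by a seminorm `q` on the subspace extends with domination by
`lam * q` (`IsPSpace.exists_extension_le_seminorm`): embed `Y` in the bounded functions on its dual
unit ball, extend each coordinate by the Hahn-Banach theorem, and project back onto `Y`. This also
provides the projections from superspaces in any universe. The domination `‖T' z‖ ≤ lam * c * q z`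
makes `lam * c` a summing constant of the extension `T'`.

For `lam = 1` the norms are equal because a summing constant of an extension is one of the operator
(`IsSummingConst.of_extension`).
-/

/-! ### Strong and weak `ℓ_p`-norms of finite families -/

section StrongWeak

variable {𝕜 : Type*} [RCLike 𝕜] {p : ℝ≥0∞} {m : ℕ}
  {X Y Z : Type*} [NormedAddCommGroup X] [NormedSpace 𝕜 X]
  [NormedAddCommGroup Y] [NormedSpace 𝕜 Y] [NormedAddCommGroup Z] [NormedSpace 𝕜 Z]

theorem strongLpNorm_top (x : Fin m → X) : strongLpNorm ∞ x = ⨆ j, ‖x j‖ :=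
  PiLp.norm_eq_ciSup _

theorem strongLpNorm_of_ne_top (hp : 1 ≤ p) (hp' : p ≠ ∞) (x : Fin m → X) :
    strongLpNorm p x = (∑ j, ‖x j‖ ^ p.toReal) ^ (1 / p.toReal) :=
  PiLp.norm_eq_sum (ENNReal.toReal_pos (zero_lt_one.trans_le hp).ne' hp') _

theorem strongLpNorm_nonneg (hp : 1 ≤ p) (x : Fin m → X) : 0 ≤ strongLpNorm p x := by
  have := Fact.mk hp
  exact norm_nonneg _

theorem strongLpNorm_le_mul (hp : 1 ≤ p) {x : Fin m → X} {y : Fin m → Y} {C : ℝ} (hC : 0 ≤ C)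
    (h : ∀ j, ‖x j‖ ≤ C * ‖y j‖) : strongLpNorm p x ≤ C * strongLpNorm p y := by
  rcases eq_or_ne p ∞ with rfl | hp'
  · rw [strongLpNorm_top, strongLpNorm_top, Real.mul_iSup_of_nonneg hC]
    exact ciSup_mono (Set.finite_range _).bddAbove h
  · have hr : 0 < p.toReal := ENNReal.toReal_pos (zero_lt_one.trans_le hp).ne' hp'
    rw [strongLpNorm_of_ne_top hp hp', strongLpNorm_of_ne_top hp hp']
    calc (∑ j, ‖x j‖ ^ p.toReal) ^ (1 / p.toReal)
        ≤ (C ^ p.toReal * ∑ j, ‖y j‖ ^ p.toReal) ^ (1 / p.toReal) := by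
          gcongr
          rw [Finset.mul_sum]
          gcongr with j
          rw [← Real.mul_rpow hC (norm_nonneg _)]
          gcongr
          exact h j
      _ = C * (∑ j, ‖y j‖ ^ p.toReal) ^ (1 / p.toReal) := by
          rw [Real.mul_rpow (by positivity) (by positivity), ← Real.rpow_mul hC,
            mul_one_div_cancel hr.ne', Real.rpow_one]

theorem strongLpNorm_mono (hp : 1 ≤ p) {x : Fin m → X} {y : Fin m → Y}
    (h : ∀ j, ‖x j‖ ≤ ‖y j‖) : strongLpNorm p x ≤ strongLpNorm p y := by
  simpa using strongLpNorm_le_mul hp zero_le_one (by simpa using h)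

theorem norm_le_strongLpNorm (hp : 1 ≤ p) (x : Fin m → X) (j : Fin m) :
    ‖x j‖ ≤ strongLpNorm p x := by
  have := Fact.mk hp
  exact PiLp.norm_apply_le (WithLp.toLp p x : PiLp p (fun _ : Fin m => X)) j

theorem strongLpNorm_one (hp : 1 ≤ p) (x : X) : strongLpNorm p (fun _ : Fin 1 => x) = ‖x‖ := by
  rcases eq_or_ne p ∞ with rfl | hp'
  · simp [strongLpNorm_top]
  · have hr : 0 < p.toReal := ENNReal.toReal_pos (zero_lt_one.trans_le hp).ne' hp'
    rw [strongLpNorm_of_ne_top hp hp']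
    simp only [Finset.univ_unique, Finset.sum_const, Finset.card_singleton, one_smul]
    rw [← Real.rpow_mul (norm_nonneg _), mul_one_div_cancel hr.ne', Real.rpow_one]

instance nonempty_dualBall : Nonempty {f : StrongDual 𝕜 X // ‖f‖ ≤ 1} := ⟨⟨0, by simp⟩⟩

theorem strongLpNorm_eval_le_weakLpNorm (hp : 1 ≤ p) (x : Fin m → X)
    (f : StrongDual 𝕜 X) (hf : ‖f‖ ≤ 1) :
    strongLpNorm p (fun j => f (x j)) ≤ weakLpNorm 𝕜 p x := by
  refine le_ciSup (f := fun f : {f : StrongDual 𝕜 X // ‖f‖ ≤ 1} =>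
    strongLpNorm p (fun j => f.1 (x j))) ⟨strongLpNorm p x, ?_⟩ ⟨f, hf⟩
  rintro _ ⟨g, rfl⟩
  exact strongLpNorm_mono hp fun j => (g.1.le_of_opNorm_le g.2 _).trans_eq (one_mul _)

theorem weakLpNorm_nonneg (hp : 1 ≤ p) (x : Fin m → X) : 0 ≤ weakLpNorm 𝕜 p x :=
  (strongLpNorm_nonneg hp _).trans (strongLpNorm_eval_le_weakLpNorm (𝕜 := 𝕜) hp x 0 (by simp))

theorem norm_le_weakLpNorm (hp : 1 ≤ p) (x : Fin m → X) (j : Fin m) :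
    ‖x j‖ ≤ weakLpNorm 𝕜 p x := by
  obtain ⟨f, hf, hfx⟩ := exists_dual_vector'' 𝕜 (x j)
  calc ‖x j‖ = ‖f (x j)‖ := by simp [hfx]
    _ ≤ strongLpNorm p (fun j => f (x j)) := norm_le_strongLpNorm hp (fun j => f (x j)) j
    _ ≤ _ := strongLpNorm_eval_le_weakLpNorm hp x f hf

theorem weakLpNorm_one_le (hp : 1 ≤ p) (x : X) : weakLpNorm 𝕜 p (fun _ : Fin 1 => x) ≤ ‖x‖ := by
  refine ciSup_le fun f => ?_
  rw [strongLpNorm_one hp]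
  exact (f.1.le_of_opNorm_le f.2 _).trans_eq (one_mul _)

theorem weakLpNorm_map_le (hp : 1 ≤ p) (A : X →L[𝕜] Y) {C : ℝ} (hC : 0 < C) (hA : ‖A‖ ≤ C)
    (x : Fin m → X) : weakLpNorm 𝕜 p (fun j => A (x j)) ≤ C * weakLpNorm 𝕜 p x := by
  refine ciSup_le fun f => ?_
  let g : StrongDual 𝕜 X := ((C⁻¹ : ℝ) : 𝕜) • f.1.comp A
  have hg : ‖g‖ ≤ 1 := by
    have h1 : ‖f.1.comp A‖ ≤ 1 * C :=
      (f.1.opNorm_comp_le A).trans (mul_le_mul f.2 hA (norm_nonneg _) zero_le_one)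
    rw [norm_smul, RCLike.norm_ofReal, abs_of_pos (inv_pos.2 hC), inv_mul_le_iff₀ hC]
    linarith
  calc strongLpNorm p (fun j => f.1 (A (x j)))
      ≤ C * strongLpNorm p (fun j => g (x j)) := strongLpNorm_le_mul hp hC.le fun j => by
        simp [g, abs_of_pos hC, mul_inv_cancel_left₀ hC.ne']
    _ ≤ C * weakLpNorm 𝕜 p x := by
        gcongr
        exact strongLpNorm_eval_le_weakLpNorm hp x g hg

theorem weakLpNorm_comp_isometry_le (hp : 1 ≤ p) (i : X →ₗᵢ[𝕜] Z) (x : Fin m → X) :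
    weakLpNorm 𝕜 p (fun j => i (x j)) ≤ weakLpNorm 𝕜 p x := by
  simpa using weakLpNorm_map_le hp i.toContinuousLinearMap zero_lt_one
    i.norm_toContinuousLinearMap_le x

end StrongWeak

/-! ### Summing constants and the `p`-summing norm -/

section SummingNorm

variable {𝕜 : Type*} [RCLike 𝕜] {p : ℝ≥0∞}
  {X Y Z : Type*} [NormedAddCommGroup X] [NormedSpace 𝕜 X]
  [NormedAddCommGroup Y] [NormedSpace 𝕜 Y] [NormedAddCommGroup Z] [NormedSpace 𝕜 Z]

theorem IsSummingConst.summingNorm_le {T : X →L[𝕜] Y} {c : ℝ} (h : IsSummingConst p T c) :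
    summingNorm p T ≤ c :=
  csInf_le ⟨0, fun _ hc => hc.1⟩ h

theorem IsPSumming.summingNorm_nonneg {T : X →L[𝕜] Y} (h : IsPSumming p T) :
    0 ≤ summingNorm p T :=
  le_csInf h fun _ hc => hc.1

/-- The infimum defining `π_p(T)` is attained. -/
theorem IsPSumming.isSummingConst_summingNorm (hp : 1 ≤ p) {T : X →L[𝕜] Y}
    (h : IsPSumming p T) : IsSummingConst p T (summingNorm p T) := by
  refine ⟨h.summingNorm_nonneg, fun m x => ?_⟩
  rcases (weakLpNorm_nonneg (𝕜 := 𝕜) hp x).eq_or_lt with h0 | h0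
  · obtain ⟨c, hc⟩ := h
    simpa [← h0] using hc.2 m x
  · rw [← div_le_iff₀ h0]
    exact le_csInf h fun c hc => (div_le_iff₀ h0).2 (hc.2 m x)

theorem IsSummingConst.norm_apply_le (hp : 1 ≤ p) {T : X →L[𝕜] Y} {c : ℝ}
    (h : IsSummingConst p T c) (x : X) : ‖T x‖ ≤ c * ‖x‖ := by
  rw [← strongLpNorm_one hp (T x)]
  exact (h.2 1 fun _ => x).trans (mul_le_mul_of_nonneg_left (weakLpNorm_one_le hp x) h.1)

theorem IsSummingConst.of_extension (hp : 1 ≤ p) {i : X →ₗᵢ[𝕜] Z} {T : X →L[𝕜] Y}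
    {T' : Z →L[𝕜] Y} (hT : ∀ x, T' (i x) = T x) {c : ℝ} (h : IsSummingConst p T' c) :
    IsSummingConst p T c := by
  refine ⟨h.1, fun m x => ?_⟩
  simp only [← hT]
  exact (h.2 m _).trans (mul_le_mul_of_nonneg_left (weakLpNorm_comp_isometry_le hp i x) h.1)

theorem summingNorm_le_of_extension (hp : 1 ≤ p) {i : X →ₗᵢ[𝕜] Z} {T : X →L[𝕜] Y}
    {T' : Z →L[𝕜] Y} (hT : ∀ x, T' (i x) = T x) (h : IsPSumming p T') :
    summingNorm p T ≤ summingNorm p T' :=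
  ((h.isSummingConst_summingNorm hp).of_extension hp hT).summingNorm_le

theorem IsSummingConst.comp (hp : 1 ≤ p) {T : X →L[𝕜] Y} {c C : ℝ} (h : IsSummingConst p T c)
    (A : Z →L[𝕜] X) (hC : 0 < C) (hA : ‖A‖ ≤ C) : IsSummingConst p (T.comp A) (C * c) := by
  refine ⟨mul_nonneg hC.le h.1, fun m z => (h.2 m _).trans ?_⟩
  rw [mul_comm C c, mul_assoc]
  exact mul_le_mul_of_nonneg_left (weakLpNorm_map_le hp A hC hA z) h.1

end SummingNorm

/-! ### Pietsch domination on a superspace -/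

section Domination

open BoundedContinuousFunction

variable {𝕜 : Type*} [RCLike 𝕜] {X Y Z : Type*} [NormedAddCommGroup X] [NormedSpace 𝕜 X]
  [NormedAddCommGroup Y] [NormedSpace 𝕜 Y] [NormedAddCommGroup Z] [NormedSpace 𝕜 Z]

/-- For `z : Z` and `r ≥ 0`, the bounded continuous function `f ↦ ‖f z‖ ^ r` on the closed unit
ball of the dual of `Z`; the ball carries the norm topology. -/
noncomputable def evalRpow (𝕜 : Type*) [RCLike 𝕜] {Z : Type*} [NormedAddCommGroup Z]
    [NormedSpace 𝕜 Z] {r : ℝ} (hr : 0 ≤ r) (z : Z) : {f : StrongDual 𝕜 Z // ‖f‖ ≤ 1} →ᵇ ℝ :=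
  ofNormedAddCommGroup (fun f => ‖f.1 z‖ ^ r)
    (((ContinuousLinearMap.apply 𝕜 𝕜 z).continuous.comp continuous_subtype_val).norm.rpow_const
      fun _ => Or.inr hr) (‖z‖ ^ r) fun f => by
    rw [Real.norm_of_nonneg (by positivity)]
    gcongr
    exact (f.1.le_of_opNorm_le f.2 _).trans_eq (one_mul _)

@[simp]
theorem evalRpow_apply {r : ℝ} (hr : 0 ≤ r) (z : Z) (f : {f : StrongDual 𝕜 Z // ‖f‖ ≤ 1}) :
    evalRpow 𝕜 hr z f = ‖f.1 z‖ ^ r := rfl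

/-- Convexity of `t ↦ t ^ r` in homogeneous form. -/
theorem add_rpow_le_weighted {r : ℝ} (hr : 1 ≤ r) {s t a b : ℝ} (hs : 0 ≤ s) (ht : 0 ≤ t)
    (ha : 0 < a) (hb : 0 < b) :
    (s + t) ^ r ≤ (a + b) ^ r * (a / (a + b) * (s ^ r / a ^ r) + b / (a + b) * (t ^ r / b ^ r)) := by
  have hab : 0 < a + b := add_pos ha hb
  have h := (convexOn_rpow hr).2 (Set.mem_Ici.2 (div_nonneg hs ha.le))
    (Set.mem_Ici.2 (div_nonneg ht hb.le)) (div_nonneg ha.le hab.le) (div_nonneg hb.le hab.le)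
    (by field_simp)
  simp only [smul_eq_mul] at h
  rw [← Real.div_rpow hs ha.le, ← Real.div_rpow ht hb.le]
  calc (s + t) ^ r = (a + b) ^ r * (a / (a + b) * (s / a) + b / (a + b) * (t / b)) ^ r := by
        rw [← Real.mul_rpow hab.le (by positivity)]
        congr 1
        field_simp
    _ ≤ _ := by gcongr

/-- The `L_r`-seminorm `z ↦ M(f ↦ ‖f z‖ ^ r) ^ (1 / r)` attached to a positive linear functional `M`
on the bounded continuous functions on the dual unit ball. Minkowski's inequality holds because the
unit ball of this homogeneous function is convex. -/
noncomputable def meanSeminorm {r : ℝ} (hr : 1 ≤ r)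
    (M : ({f : StrongDual 𝕜 Z // ‖f‖ ≤ 1} →ᵇ ℝ) →ₗ[ℝ] ℝ)
    (hM : ∀ g : {f : StrongDual 𝕜 Z // ‖f‖ ≤ 1} →ᵇ ℝ, (∀ f, 0 ≤ g f) → 0 ≤ M g) :
    Seminorm 𝕜 Z :=
  have hr0 : 0 < r := zero_lt_one.trans_le hr
  have hnn : ∀ z : Z, 0 ≤ M (evalRpow 𝕜 hr0.le z) := fun z => hM _ fun f => by
    simp only [evalRpow_apply]; positivity
  have hmono : ∀ g h : {f : StrongDual 𝕜 Z // ‖f‖ ≤ 1} →ᵇ ℝ, (∀ f, g f ≤ h f) → M g ≤ M h :=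
    fun g h hgh => by
      have := hM (h - g) fun f => by simpa using hgh f
      rw [map_sub] at this
      linarith
  Seminorm.of (fun z => M (evalRpow 𝕜 hr0.le z) ^ (1 / r))
    (fun z w => by
      have key : ∀ a b : ℝ, 0 < a → 0 < b → M (evalRpow 𝕜 hr0.le z) ^ (1 / r) ≤ a →
          M (evalRpow 𝕜 hr0.le w) ^ (1 / r) ≤ b →
          M (evalRpow 𝕜 hr0.le (z + w)) ^ (1 / r) ≤ a + b := by
        intro a b ha hb hza hwb
        have hab : 0 < a + b := add_pos ha hb
        rw [one_div, Real.rpow_inv_le_iff_of_pos (hnn _) (by positivity) hr0] at hza hwb ⊢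
        calc M (evalRpow 𝕜 hr0.le (z + w))
            ≤ M ((a + b) ^ r • ((a / (a + b) / a ^ r) • evalRpow 𝕜 hr0.le z
                + (b / (a + b) / b ^ r) • evalRpow 𝕜 hr0.le w)) := by
              refine hmono _ _ fun f => ?_
              simp only [evalRpow_apply, BoundedContinuousFunction.coe_smul,
                BoundedContinuousFunction.coe_add, Pi.add_apply, smul_eq_mul, map_add]
              calc ‖f.1 z + f.1 w‖ ^ r ≤ (‖f.1 z‖ + ‖f.1 w‖) ^ r := by
                    gcongr
                    exact norm_add_le _ _
                _ ≤ _ := add_rpow_le_weighted hr (norm_nonneg _) (norm_nonneg _) ha hb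
                _ = _ := by ring
          _ = (a + b) ^ r * (a / (a + b) * (M (evalRpow 𝕜 hr0.le z) / a ^ r)
                + b / (a + b) * (M (evalRpow 𝕜 hr0.le w) / b ^ r)) := by
              simp only [map_smul, map_add, smul_eq_mul]
              ring
          _ ≤ (a + b) ^ r * (a / (a + b) * 1 + b / (a + b) * 1) := by
              gcongr
              · exact div_le_one_of_le₀ hza (by positivity)
              · exact div_le_one_of_le₀ hwb (by positivity)
          _ = (a + b) ^ r := by
              field_simp
      -- `key` needs positive bounds, and either seminorm value may vanish
      refine le_of_forall_pos_le_add fun ε hε => ?_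
      have h1 : 0 ≤ M (evalRpow 𝕜 hr0.le z) ^ (1 / r) := Real.rpow_nonneg (hnn z) _
      have h2 : 0 ≤ M (evalRpow 𝕜 hr0.le w) ^ (1 / r) := Real.rpow_nonneg (hnn w) _
      refine (key _ _ (add_pos_of_nonneg_of_pos h1 (half_pos hε))
        (add_pos_of_nonneg_of_pos h2 (half_pos hε)) (by linarith) (by linarith)).trans_eq ?_
      ring)
    (fun a z => by
      have h : evalRpow 𝕜 hr0.le (a • z) = ‖a‖ ^ r • evalRpow 𝕜 hr0.le z := by
        ext f
        simp [Real.mul_rpow]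
      rw [h, map_smul, smul_eq_mul, Real.mul_rpow (by positivity) (hnn z),
        ← Real.rpow_mul (norm_nonneg a), mul_one_div_cancel hr0.ne', Real.rpow_one])

theorem meanSeminorm_rpow {r : ℝ} (hr : 1 ≤ r)
    (M : ({f : StrongDual 𝕜 Z // ‖f‖ ≤ 1} →ᵇ ℝ) →ₗ[ℝ] ℝ)
    (hM : ∀ g : {f : StrongDual 𝕜 Z // ‖f‖ ≤ 1} →ᵇ ℝ, (∀ f, 0 ≤ g f) → 0 ≤ M g) (z : Z) :
    meanSeminorm hr M hM z ^ r = M (evalRpow 𝕜 (zero_le_one.trans hr) z) := by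
  have hr0 : 0 < r := zero_lt_one.trans_le hr
  have hnn : 0 ≤ M (evalRpow 𝕜 hr0.le z) := hM _ fun f => by
    simp only [evalRpow_apply]; positivity
  change (M (evalRpow 𝕜 hr0.le z) ^ (1 / r)) ^ r = _
  rw [← Real.rpow_mul hnn, one_div_mul_cancel hr0.ne', Real.rpow_one]

/-- For a summing constant `c` of `T`, the function `f ↦ ∑ (c ^ r ‖f (i x_j)‖ ^ r - ‖T x_j‖ ^ r)` on
the dual unit ball of `Z` is not bounded above by a negative number: this is the summing inequality,
as every functional in the dual unit ball of `X` is the restriction of one in that of `Z`. -/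
theorem IsSummingConst.nonneg_of_forall_sum_le {p : ℝ≥0∞} (hp : 1 ≤ p) (hp' : p ≠ ∞)
    {T : X →L[𝕜] Y} {c : ℝ} (h : IsSummingConst p T c) (i : X →ₗᵢ[𝕜] Z) {m : ℕ} (x : Fin m → X)
    {t : ℝ} (ht : ∀ f : {f : StrongDual 𝕜 Z // ‖f‖ ≤ 1},
      ∑ j, (c ^ p.toReal * ‖f.1 (i (x j))‖ ^ p.toReal - ‖T (x j)‖ ^ p.toReal) ≤ t) : 0 ≤ t := by
  have hr : 0 < p.toReal := ENNReal.toReal_pos (zero_lt_one.trans_le hp).ne' hp'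
  have hc := h.1
  set S := ∑ j, ‖T (x j)‖ ^ p.toReal with hS
  have hS0 : 0 ≤ S := by positivity
  have hSt : 0 ≤ S + t := by
    -- evaluate the hypothesis at the zero functional
    have := ht ⟨0, by simp⟩
    simp [Real.zero_rpow hr.ne'] at this
    linarith
  have hweak : c * weakLpNorm 𝕜 p x ≤ (S + t) ^ (1 / p.toReal) := by
    rw [weakLpNorm, Real.mul_iSup_of_nonneg hc]
    refine ciSup_le fun g => ?_
    obtain ⟨f, hf, hfg⟩ := exists_extension_norm_eq (LinearMap.range i.toLinearMap)
      (g.1.comp (i.equivRange.symm.toContinuousLinearEquiv :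
        LinearMap.range i.toLinearMap →L[𝕜] X))
    have hf1 : ‖f‖ ≤ 1 := by
      rw [hfg]
      refine ContinuousLinearMap.opNorm_le_bound _ zero_le_one fun y => ?_
      refine (g.1.le_of_opNorm_le g.2 _).trans_eq ?_
      simp
    have hfi : ∀ y, f (i y) = g.1 y := fun y => by
      have := hf (i.equivRange y)
      simpa using this
    have h1 := ht ⟨f, hf1⟩
    simp only [hfi, Finset.sum_sub_distrib, ← Finset.mul_sum] at h1
    rw [strongLpNorm_of_ne_top hp hp', one_div, Real.le_rpow_inv_iff_of_pos (by positivity) hSt hr,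
      Real.mul_rpow hc (by positivity), ← Real.rpow_mul (by positivity),
      inv_mul_cancel₀ hr.ne', Real.rpow_one]
    linarith
  have h2 := (h.2 m x).trans hweak
  rw [strongLpNorm_of_ne_top hp hp', Real.rpow_le_rpow_iff hS0 hSt (by positivity)] at h2
  linarith

/-- The cone of bounded functions on the dual unit ball of `Z` that dominate some function
`f ↦ ∑ (a ‖f (i x_j)‖ ^ r - ‖T x_j‖ ^ r)`. -/
noncomputable def dominationCone {r : ℝ} (hr : 0 < r) (a : ℝ) (i : X →ₗᵢ[𝕜] Z) (T : X →L[𝕜] Y) :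
    PointedCone ℝ ({f : StrongDual 𝕜 Z // ‖f‖ ≤ 1} →ᵇ ℝ) where
  carrier := {g | ∃ (m : ℕ) (x : Fin m → X), ∀ f : {f : StrongDual 𝕜 Z // ‖f‖ ≤ 1},
    ∑ j, (a * ‖f.1 (i (x j))‖ ^ r - ‖T (x j)‖ ^ r) ≤ g f}
  add_mem' := by
    rintro g h ⟨m, x, hx⟩ ⟨n, y, hy⟩
    refine ⟨m + n, Fin.append x y, fun f => ?_⟩
    simp only [Fin.sum_univ_add, Fin.append_left, Fin.append_right]
    exact add_le_add (hx f) (hy f)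
  zero_mem' := ⟨0, Fin.elim0, fun f => by simp⟩
  smul_mem' := by
    rintro s g ⟨m, x, hx⟩
    -- by homogeneity, rescaling the vectors by `s ^ (1 / r)` multiplies the sum by `s`
    refine ⟨m, fun j => (((s : ℝ) ^ (1 / r) : ℝ) : 𝕜) • x j, fun f => ?_⟩
    have hs : |(s : ℝ) ^ (1 / r)| ^ r = s := by
      rw [abs_of_nonneg (Real.rpow_nonneg s.2 _), ← Real.rpow_mul s.2, one_div_mul_cancel hr.ne',
        Real.rpow_one]
    have h : ∀ j, a * ‖f.1 (i ((((s : ℝ) ^ (1 / r) : ℝ) : 𝕜) • x j))‖ ^ r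
        - ‖T ((((s : ℝ) ^ (1 / r) : ℝ) : 𝕜) • x j)‖ ^ r
        = s * (a * ‖f.1 (i (x j))‖ ^ r - ‖T (x j)‖ ^ r) := fun j => by
      rw [map_smul, map_smul, map_smul, norm_smul, norm_smul, RCLike.norm_ofReal,
        Real.mul_rpow (abs_nonneg _) (norm_nonneg _), Real.mul_rpow (abs_nonneg _) (norm_nonneg _),
        hs]
      ring
    simp only [h, ← Finset.mul_sum]
    exact mul_le_mul_of_nonneg_left (hx f) s.2

/-- Pietsch domination, with a positive normalized functional on the bounded continuous functions on
the dual unit ball of the superspace `Z` in place of a probability measure. -/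
theorem IsSummingConst.exists_mean {p : ℝ≥0∞} (hp : 1 ≤ p) (hp' : p ≠ ∞) {T : X →L[𝕜] Y} {c : ℝ}
    (h : IsSummingConst p T c) (i : X →ₗᵢ[𝕜] Z) :
    ∃ M : ({f : StrongDual 𝕜 Z // ‖f‖ ≤ 1} →ᵇ ℝ) →ₗ[ℝ] ℝ, M 1 = 1 ∧
      (∀ g : {f : StrongDual 𝕜 Z // ‖f‖ ≤ 1} →ᵇ ℝ, (∀ f, 0 ≤ g f) → 0 ≤ M g) ∧
      ∀ x, ‖T x‖ ^ p.toReal ≤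
        c ^ p.toReal * M (evalRpow 𝕜 (ENNReal.toReal_nonneg (a := p)) (i x)) := by
  have hr : 0 < p.toReal := ENNReal.toReal_pos (zero_lt_one.trans_le hp).ne' hp'
  have hne : (1 : {f : StrongDual 𝕜 Z // ‖f‖ ≤ 1} →ᵇ ℝ) ≠ 0 := fun h0 => by
    simpa using DFunLike.congr_fun h0 ⟨0, by simp⟩
  obtain ⟨M, hM1, hM⟩ := riesz_extension (dominationCone hr (c ^ p.toReal) i T)
    (LinearPMap.mkSpanSingleton 1 (1 : ℝ) hne) (by
      rintro ⟨y, hy⟩ hmem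
      obtain ⟨t, rfl⟩ := Submodule.mem_span_singleton.1 hy
      obtain ⟨m, x, hx⟩ := hmem
      rw [LinearPMap.mkSpanSingleton'_apply]
      simpa using h.nonneg_of_forall_sum_le hp hp' i x (t := t) fun f => by simpa using hx f)
    (by
      intro y
      -- `‖y‖ • 1 + y` is a nonnegative function, which the empty family shows to be in the cone
      refine ⟨⟨‖y‖ • 1, Submodule.smul_mem _ _ (Submodule.mem_span_singleton_self _)⟩, 0,
        Fin.elim0, fun f => ?_⟩
      have := (abs_le.1 (y.norm_coe_le_norm f)).1
      simp
      linarith)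
  have h1 : M 1 = 1 := by
    exact (hM1 ⟨1, Submodule.mem_span_singleton_self _⟩).trans
      (LinearPMap.mkSpanSingleton_apply ℝ ℝ hne (1 : ℝ))
  refine ⟨M, h1, fun g hg => hM g ⟨0, Fin.elim0, fun f => by simpa using hg f⟩, fun x => ?_⟩
  have h2 := hM (c ^ p.toReal • evalRpow 𝕜 hr.le (i x) - ‖T x‖ ^ p.toReal • 1)
    ⟨1, fun _ => x, fun f => by simp⟩
  rw [map_sub, map_smul, map_smul, h1, smul_eq_mul, smul_eq_mul, mul_one] at h2
  linarith

/-- A `p`-summing operator on a subspace of `Z` is dominated there by a seminorm on all of `Z` that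
is itself `p`-summing with constant one. -/
theorem IsSummingConst.exists_seminorm {p : ℝ≥0∞} (hp : 1 ≤ p) {T : X →L[𝕜] Y} {c : ℝ}
    (h : IsSummingConst p T c) (i : X →ₗᵢ[𝕜] Z) :
    ∃ q : Seminorm 𝕜 Z, (∀ x, ‖T x‖ ≤ c * q (i x)) ∧
      ∀ (m : ℕ) (z : Fin m → Z), strongLpNorm p (fun j => q (z j)) ≤ weakLpNorm 𝕜 p z := by
  rcases eq_or_ne p ∞ with rfl | hp'
  · refine ⟨normSeminorm 𝕜 Z, fun x => by simpa using h.norm_apply_le hp x, fun m z => ?_⟩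
    rw [strongLpNorm_top]
    exact Real.iSup_le (fun j => by simpa using norm_le_weakLpNorm hp z j)
      (weakLpNorm_nonneg hp z)
  · have hr : 0 < p.toReal := ENNReal.toReal_pos (zero_lt_one.trans_le hp).ne' hp'
    have hr1 : 1 ≤ p.toReal := by
      simpa using ENNReal.toReal_mono hp' hp
    obtain ⟨M, hM1, hM, hT⟩ := h.exists_mean hp hp' i
    refine ⟨meanSeminorm hr1 M hM, fun x => ?_, fun m z => ?_⟩
    · rw [← Real.rpow_le_rpow_iff (norm_nonneg _) (mul_nonneg h.1 (apply_nonneg _ _)) hr,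
        Real.mul_rpow h.1 (apply_nonneg _ _), meanSeminorm_rpow]
      exact hT x
    · have hw := weakLpNorm_nonneg (𝕜 := 𝕜) hp z
      rw [strongLpNorm_of_ne_top hp hp', one_div, Real.rpow_inv_le_iff_of_pos (by positivity) hw hr]
      simp only [Real.norm_of_nonneg (apply_nonneg (meanSeminorm hr1 M hM) _), meanSeminorm_rpow]
      have h2 := hM (weakLpNorm 𝕜 p z ^ p.toReal • 1 - ∑ j, evalRpow 𝕜 hr.le (z j)) fun f => by
        have h3 := strongLpNorm_eval_le_weakLpNorm hp z f.1 f.2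
        rw [strongLpNorm_of_ne_top hp hp', one_div,
          Real.rpow_inv_le_iff_of_pos (by positivity) hw hr] at h3
        simpa using h3
      rw [map_sub, map_smul, hM1, map_sum, smul_eq_mul, mul_one] at h2
      linarith

end Domination

/-! ### Extension of operators into and from a `P_lam`-space -/

section Extension

/-- Hahn-Banach for a functional on an isometrically embedded subspace and a dominating seminorm. -/
theorem exists_dual_extension_of_le_seminorm {𝕜 : Type*} [RCLike 𝕜] {X Z : Type*}
    [NormedAddCommGroup X] [NormedSpace 𝕜 X] [NormedAddCommGroup Z] [NormedSpace 𝕜 Z]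
    (i : X →ₗᵢ[𝕜] Z) (g : X →ₗ[𝕜] 𝕜) (q : Seminorm 𝕜 Z) (h : ∀ x, ‖g x‖ ≤ q (i x)) :
    ∃ g' : Z →ₗ[𝕜] 𝕜, (∀ x, g' (i x) = g x) ∧ ∀ z, ‖g' z‖ ≤ q z := by
  obtain ⟨g', hg, hq⟩ := Module.Dual.exists_extension_of_le_seminorm
    (LinearMap.range i.toLinearMap) (g.comp i.equivRange.symm.toLinearEquiv.toLinearMap) (p := q)
    (by
      intro y
      obtain ⟨x, rfl⟩ := i.equivRange.surjective y
      simpa using h x)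
  exact ⟨g', fun x => by simpa using hg (i.equivRange x), hq⟩

/-- An operator into a `P_lam`-space that is dominated on a subspace by a continuous seminorm `q` of
the whole space extends with domination by `lam * q`. The target is embedded isometrically in the
space of bounded functions on its dual unit ball, into which one extends coordinate by coordinate;
the projection then brings the extension back. -/
theorem IsPSpace.exists_extension_le_seminorm {𝕜 : Type} [RCLike 𝕜] {X Y Z : Type*}
    [NormedAddCommGroup X] [NormedSpace 𝕜 X] [NormedAddCommGroup Y] [NormedSpace 𝕜 Y]
    [NormedAddCommGroup Z] [NormedSpace 𝕜 Z] {lam : ℝ} (hY : IsPSpace 𝕜 lam Y)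
    (i : X →ₗᵢ[𝕜] Z) (T : X →L[𝕜] Y) (q : Seminorm 𝕜 Z) (hT : ∀ x, ‖T x‖ ≤ q (i x))
    {K : ℝ} (hK : ∀ z, q z ≤ K * ‖z‖) :
    ∃ T' : Z →L[𝕜] Y, (∀ x, T' (i x) = T x) ∧ ∀ z, ‖T' z‖ ≤ lam * q z := by
  obtain ⟨hlam, hproj⟩ := hY
  let D := {f : StrongDual 𝕜 Y // ‖f‖ ≤ 1}
  let ev : Y →ₗ[𝕜] lp (fun _ : D => 𝕜) ∞ :=
    { toFun := fun y => ⟨fun f => f.1 y, memℓp_infty ⟨‖y‖, by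
        rintro _ ⟨f, rfl⟩
        exact (f.1.le_of_opNorm_le f.2 _).trans_eq (one_mul _)⟩⟩
      map_add' := fun y y' => by ext f; exact map_add f.1 y y'
      map_smul' := fun a y => by ext f; exact map_smul f.1 a y }
  let J : Y →ₗᵢ[𝕜] lp (fun _ : D => 𝕜) ∞ := ⟨ev, fun y => by
    refine le_antisymm (lp.norm_le_of_forall_le (norm_nonneg _) fun f =>
      (f.1.le_of_opNorm_le f.2 _).trans_eq (one_mul _)) ?_
    obtain ⟨f, hf, hfy⟩ := exists_dual_vector'' 𝕜 y
    calc ‖y‖ = ‖ev y ⟨f, hf⟩‖ := by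
          change ‖y‖ = ‖f y‖
          simp [hfy]
      _ ≤ ‖ev y‖ := lp.norm_apply_le_norm ENNReal.top_ne_zero _ _⟩
  obtain ⟨P, hP, hPn⟩ := hproj _ J
  have hext : ∀ f : D, ∃ g : Z →ₗ[𝕜] 𝕜, (∀ x, g (i x) = f.1 (T x)) ∧ ∀ z, ‖g z‖ ≤ q z :=
    fun f => exists_dual_extension_of_le_seminorm i (f.1.comp T).toLinearMap q fun x =>
      ((f.1.le_of_opNorm_le f.2 _).trans_eq (one_mul _)).trans (hT x)
  choose g hg hgq using hext
  let G : Z →ₗ[𝕜] lp (fun _ : D => 𝕜) ∞ :=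
    { toFun := fun z => ⟨fun f => g f z, memℓp_infty ⟨q z, by
        rintro _ ⟨f, rfl⟩
        exact hgq f z⟩⟩
      map_add' := fun y y' => by ext f; exact map_add (g f) y y'
      map_smul' := fun a y => by ext f; exact map_smul (g f) a y }
  have hGq : ∀ z, ‖G z‖ ≤ q z := fun z =>
    lp.norm_le_of_forall_le (apply_nonneg _ _) fun f => hgq f z
  refine ⟨P.comp (G.mkContinuous K fun z => (hGq z).trans (hK z)), fun x => ?_, fun z => ?_⟩
  · have : G (i x) = J (T x) := by
      ext f
      exact hg f x
    change P (G (i x)) = T x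
    rw [this, hP]
  · change ‖P (G z)‖ ≤ _
    exact (P.le_of_opNorm_le hPn _).trans
      (mul_le_mul_of_nonneg_left (hGq z) (zero_le_one.trans hlam))

/-- A `P_lam`-space is the range of a projection of norm at most `lam` from every superspace,
without restriction on the universe of the superspace. -/
theorem IsPSpace.exists_projection {𝕜 : Type} [RCLike 𝕜] {Y Z : Type*}
    [NormedAddCommGroup Y] [NormedSpace 𝕜 Y] [NormedAddCommGroup Z] [NormedSpace 𝕜 Z] {lam : ℝ}
    (hY : IsPSpace 𝕜 lam Y) (i : Y →ₗᵢ[𝕜] Z) :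
    ∃ P : Z →L[𝕜] Y, (∀ y, P (i y) = y) ∧ ‖P‖ ≤ lam := by
  obtain ⟨P, hP, hPn⟩ := hY.exists_extension_le_seminorm i (.id 𝕜 Y) (normSeminorm 𝕜 Z)
    (fun x => by simp) (K := 1) (fun z => by simp)
  exact ⟨P, hP, P.opNorm_le_bound (zero_le_one.trans hY.1) hPn⟩

/-- Extension of `p`-summing operators into a `P_lam`-space: the operator is dominated on the subspace
by a `p`-summing seminorm of the superspace, and so is, up to `lam`, its extension. -/
theorem IsPSpace.exists_extension_to {𝕜 : Type} [RCLike 𝕜] {p : ℝ≥0∞} (hp : 1 ≤ p)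
    {X Y Z : Type*} [NormedAddCommGroup X] [NormedSpace 𝕜 X] [NormedAddCommGroup Y]
    [NormedSpace 𝕜 Y] [NormedAddCommGroup Z] [NormedSpace 𝕜 Z] {lam : ℝ}
    (hY : IsPSpace 𝕜 lam Y) (i : X →ₗᵢ[𝕜] Z) (T : X →L[𝕜] Y) (hT : IsPSumming p T) :
    ∃ T' : Z →L[𝕜] Y, (∀ x, T' (i x) = T x) ∧ IsSummingConst p T' (lam * summingNorm p T) := by
  have hc := hT.isSummingConst_summingNorm hp
  have hlam : 0 ≤ lam := zero_le_one.trans hY.1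
  obtain ⟨q, hTq, hq⟩ := hc.exists_seminorm hp i
  have hqn : ∀ z, q z ≤ ‖z‖ := fun z => by
    have h := (hq 1 fun _ => z).trans (weakLpNorm_one_le hp z)
    rw [strongLpNorm_one hp] at h
    exact (le_abs_self _).trans h
  let C : NNReal := ⟨summingNorm p T, hc.1⟩
  obtain ⟨T', hT', hle⟩ := hY.exists_extension_le_seminorm i T (C • q) (fun x => hTq x)
    (K := summingNorm p T) (fun z => mul_le_mul_of_nonneg_left (hqn z) hc.1)
  refine ⟨T', hT', mul_nonneg hlam hc.1, fun m z => ?_⟩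
  calc strongLpNorm p (fun j => T' (z j))
      ≤ lam * summingNorm p T * strongLpNorm p (fun j => q (z j)) :=
        strongLpNorm_le_mul hp (mul_nonneg hlam hc.1) fun j => by
          rw [Real.norm_of_nonneg (apply_nonneg q _), mul_assoc]
          exact hle (z j)
    _ ≤ _ := mul_le_mul_of_nonneg_left (hq m z) (mul_nonneg hlam hc.1)

/-- Extension of `p`-summing operators from a `P_lam`-space: compose with a projection. -/
theorem IsPSpace.exists_extension_from {𝕜 : Type} [RCLike 𝕜] {p : ℝ≥0∞} (hp : 1 ≤ p)
    {X Y Z : Type*} [NormedAddCommGroup X] [NormedSpace 𝕜 X] [NormedAddCommGroup Y]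
    [NormedSpace 𝕜 Y] [NormedAddCommGroup Z] [NormedSpace 𝕜 Z] {lam : ℝ}
    (hY : IsPSpace 𝕜 lam Y) (i : Y →ₗᵢ[𝕜] Z) (T : Y →L[𝕜] X) (hT : IsPSumming p T) :
    ∃ T' : Z →L[𝕜] X, (∀ y, T' (i y) = T y) ∧ IsSummingConst p T' (lam * summingNorm p T) := by
  obtain ⟨P, hP, hPn⟩ := hY.exists_projection i
  exact ⟨T.comp P, fun y => by simp [hP],
    (hT.isSummingConst_summingNorm hp).comp hp P (zero_lt_one.trans_le hY.1) hPn⟩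

end Extension

theorem theoremT2 {𝕜 : Type} [RCLike 𝕜] (p : ℝ≥0∞) (hp : 1 ≤ p)
    {X Y Z : Type*}
    [NormedAddCommGroup X] [NormedSpace 𝕜 X] [CompleteSpace X]
    [NormedAddCommGroup Y] [NormedSpace 𝕜 Y] [CompleteSpace Y]
    [NormedAddCommGroup Z] [NormedSpace 𝕜 Z] [CompleteSpace Z] :
    (∀ lam : ℝ, IsPSpace 𝕜 lam Y →
      (∀ (i : X →ₗᵢ[𝕜] Z) (T : X →L[𝕜] Y), IsPSumming p T →
        ∃ T' : Z →L[𝕜] Y, (∀ x : X, T' (i x) = T x) ∧ IsPSumming p T' ∧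
          summingNorm p T' ≤ lam * summingNorm p T) ∧
      (∀ (i : Y →ₗᵢ[𝕜] Z) (T : Y →L[𝕜] X), IsPSumming p T →
        ∃ T' : Z →L[𝕜] X, (∀ y : Y, T' (i y) = T y) ∧ IsPSumming p T' ∧
          summingNorm p T' ≤ lam * summingNorm p T)) ∧
    (IsPSpace 𝕜 1 Y →
      (∀ (i : X →ₗᵢ[𝕜] Z) (T : X →L[𝕜] Y), IsPSumming p T →
        ∃ T' : Z →L[𝕜] Y, (∀ x : X, T' (i x) = T x) ∧ IsPSumming p T' ∧
          summingNorm p T' = summingNorm p T) ∧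
      (∀ (i : Y →ₗᵢ[𝕜] Z) (T : Y →L[𝕜] X), IsPSumming p T →
        ∃ T' : Z →L[𝕜] X, (∀ y : Y, T' (i y) = T y) ∧ IsPSumming p T' ∧
          summingNorm p T' = summingNorm p T)) := by
  refine ⟨fun lam hY => ⟨fun i T hT => ?_, fun i T hT => ?_⟩,
    fun hY => ⟨fun i T hT => ?_, fun i T hT => ?_⟩⟩
  · obtain ⟨T', hT', hc⟩ := hY.exists_extension_to hp i T hT
    exact ⟨T', hT', ⟨_, hc⟩, hc.summingNorm_le⟩
  · obtain ⟨T', hT', hc⟩ := hY.exists_extension_from hp i T hT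
    exact ⟨T', hT', ⟨_, hc⟩, hc.summingNorm_le⟩
  · obtain ⟨T', hT', hc⟩ := hY.exists_extension_to hp i T hT
    exact ⟨T', hT', ⟨_, hc⟩, le_antisymm (hc.summingNorm_le.trans_eq (one_mul _))
      (summingNorm_le_of_extension hp hT' ⟨_, hc⟩)⟩
  · obtain ⟨T', hT', hc⟩ := hY.exists_extension_from hp i T hT
    exact ⟨T', hT', ⟨_, hc⟩, le_antisymm (hc.summingNorm_le.trans_eq (one_mul _))
      (summingNorm_le_of_extension hp hT' ⟨_, hc⟩)⟩
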